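/- Let $M$ be a smooth manifold of real dimension $4n$ with a hypercomplex structure $(I,J,K)$, i.e. smooth almost complex structures $I,J,K$ on $TM$ that are integrable (vanishing Nijenhuis tensors) and satisfy $I^2=J^2=K^2=IJK=-\mathrm{Id}_{TM}$. Let $\nabla$ be the Obata connection of $(M,I,J,K)$, i.e. the (necessarily unique) torsion-free connection on $TM$ with $\nabla I=\nabla J=\nabla K=0$. Let $\eta$ be a smooth complex-valued differential form on $M$ of Hodge type $(2n,0)$ with respect to $I$ (so $\eta$ has top degree among the $(p,0)$-forms on $(M,I)$). Suppose that * $\eta$ is holomorphic, i.e. $\bar\partial\eta=0$, where $\bar\partial\eta$ is the $(2n,1)$-part of $d\eta$ with respect to $I$; and * $\eta$ is $\mathbb H$-real, i.e. $J(\bar\eta)=\eta$, where $J$ acts on forms multiplicatively: $(J\alpha)(v_1,\dots,v_{2n})=\alpha(Jv_1,\dots,Jv_{2n})$. Then $\eta$ is parallel with respect to the Obata connection: $\nabla\eta=0$. -/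

import Mathlib

open Bundle VectorField
open scoped Manifold ContDiff

noncomputable section

section Structures

/-! ### Hypercomplex manifolds and the Obata connection

`M` is a smooth manifold without boundary, modelled on a real vector space `E`. -/

variable (E : Type*) [NormedAddCommGroup E] [NormedSpace ℝ E]
  (M : Type*) [TopologicalSpace M] [ChartedSpace E M]

/-- A field of endomorphisms of the tangent spaces of `M`. -/
abbrev TangentEndo : Type _ :=
  Π x : M, TangentSpace 𝓘(ℝ, E) x →L[ℝ] TangentSpace 𝓘(ℝ, E) x

/-- A (not necessarily differentiable) vector field on `M`. -/
abbrev TangentField : Type _ := Π x : M, TangentSpace 𝓘(ℝ, E) x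

variable {E M}

/-- The vector field `A X`. -/
def TangentEndo.act (A : TangentEndo E M) (X : TangentField E M) : TangentField E M :=
  fun x ↦ A x (X x)

lemma TangentEndo.act_add (A : TangentEndo E M) (X Y : TangentField E M) :
    A.act (X + Y) = A.act X + A.act Y := by
  funext x; simp [TangentEndo.act]

lemma TangentEndo.act_smul (A : TangentEndo E M) (f : M → ℝ) (X : TangentField E M) :
    A.act (f • X) = f • A.act X := by
  funext x; simp [TangentEndo.act]

variable [IsManifold 𝓘(ℝ, E) ∞ M]

/-- `A` is a smooth section of the bundle `End(TM)`. -/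
def TangentEndo.IsSmooth (A : TangentEndo E M) : Prop :=
  ContMDiff 𝓘(ℝ, E) (𝓘(ℝ, E).prod 𝓘(ℝ, E →L[ℝ] E)) ∞
    (fun x ↦ TotalSpace.mk' (E →L[ℝ] E)
      (E := fun x : M ↦ TangentSpace 𝓘(ℝ, E) x →L[ℝ] TangentSpace 𝓘(ℝ, E) x) x (A x))

/-- Integrability of an almost complex structure `A`: its Nijenhuis tensor
`N(X, Y) = [AX, AY] - A[AX, Y] - A[X, AY] - [X, Y]` vanishes. -/
def TangentEndo.IsIntegrable (A : TangentEndo E M) : Prop :=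
  ∀ (X Y : TangentField E M) (x : M), MDiffAt (T% X) x → MDiffAt (T% Y) x →
    mlieBracket 𝓘(ℝ, E) (A.act X) (A.act Y) x - A x (mlieBracket 𝓘(ℝ, E) (A.act X) Y x)
      - A x (mlieBracket 𝓘(ℝ, E) X (A.act Y) x) - mlieBracket 𝓘(ℝ, E) X Y x = 0

variable (E M) in
/-- A hypercomplex structure: smooth integrable almost complex structures `I`, `J`, `K` with
`I² = J² = K² = IJK = -1`. -/
structure HypercomplexStructure where
  I : TangentEndo E M
  J : TangentEndo E M
  K : TangentEndo E M
  smooth_I : I.IsSmooth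
  smooth_J : J.IsSmooth
  smooth_K : K.IsSmooth
  I_sq : ∀ x v, I x (I x v) = -v
  J_sq : ∀ x v, J x (J x v) = -v
  K_sq : ∀ x v, K x (K x v) = -v
  IJK : ∀ x v, I x (J x (K x v)) = -v
  integrable_I : I.IsIntegrable
  integrable_J : J.IsIntegrable
  integrable_K : K.IsIntegrable

/-- The connection `D` on `TM` preserves the field of endomorphisms `A`, i.e. `∇A = 0`:
`∇_v (A Y) = A (∇_v Y)`. -/
def TangentEndo.IsPreservedBy (A : TangentEndo E M)
    (D : CovariantDerivative 𝓘(ℝ, E) E (TangentSpace 𝓘(ℝ, E) : M → Type _)) : Prop :=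
  ∀ (Y : TangentField E M) (x : M), MDiffAt (T% Y) x →
    ∀ v : TangentSpace 𝓘(ℝ, E) x, D (A.act Y) x v = A x (D Y x v)

namespace HypercomplexStructure

lemma mdiffAt_act {A : TangentEndo E M} (hA : A.IsSmooth) {X : TangentField E M} {x : M}
    (hX : MDiffAt (T% X) x) : MDiffAt (T% (A.act X)) x :=
  ((hA x).mdifferentiableAt (by simp)).clm_bundle_apply hX

variable (h : HypercomplexStructure E M)

lemma IJ (x : M) (v : TangentSpace 𝓘(ℝ, E) x) : h.I x (h.J x v) = h.K x v := by
  have := h.IJK x (h.K x v)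
  rw [h.K_sq, map_neg, map_neg] at this
  exact neg_injective this

lemma JK (x : M) (v : TangentSpace 𝓘(ℝ, E) x) : h.J x (h.K x v) = h.I x v := by
  have := congrArg (h.I x) (h.IJK x v)
  rw [h.I_sq, map_neg] at this
  exact neg_injective this

lemma IK (x : M) (v : TangentSpace 𝓘(ℝ, E) x) : h.I x (h.K x v) = -h.J x v := by
  rw [← h.IJ, h.I_sq]

lemma KJ (x : M) (v : TangentSpace 𝓘(ℝ, E) x) : h.K x (h.J x v) = -h.I x v := by
  rw [← h.IJ, h.J_sq, map_neg]

lemma JI (x : M) (v : TangentSpace 𝓘(ℝ, E) x) : h.J x (h.I x v) = -h.K x v := by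
  rw [← h.JK, h.J_sq]

lemma KI (x : M) (v : TangentSpace 𝓘(ℝ, E) x) : h.K x (h.I x v) = h.J x v := by
  have := h.KJ x (h.K x v)
  rw [h.JK, h.IK, neg_neg] at this
  exact this

/-- `½ ([X, Y] + I[IX, Y] - J[X, JY] + K[IX, JY])`. -/
def obataBracket (X Y : TangentField E M) (x : M) : TangentSpace 𝓘(ℝ, E) x :=
  (1 / 2 : ℝ) • (mlieBracket 𝓘(ℝ, E) X Y x + h.I x (mlieBracket 𝓘(ℝ, E) (h.I.act X) Y x)
    - h.J x (mlieBracket 𝓘(ℝ, E) X (h.J.act Y) x)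
    + h.K x (mlieBracket 𝓘(ℝ, E) (h.I.act X) (h.J.act Y) x))

variable [FiniteDimensional ℝ E]

lemma tensorialAt_obataBracket (Y : TangentField E M) (x : M) :
    TensorialAt 𝓘(ℝ, E) E (h.obataBracket · Y x) x where
  smul {f X} hf hX := by
    have hIX := mdiffAt_act h.smooth_I hX
    simp only [obataBracket, TangentEndo.act_smul, mlieBracket_smul_left hf hX, mlieBracket_smul_left hf hIX,
      map_add, map_smul, map_neg, neg_smul]
    simp only [TangentEndo.act, h.I_sq, h.KI]
    module
  add {X X'} hX hX' := by
    have hIX := mdiffAt_act h.smooth_I hX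
    have hIX' := mdiffAt_act h.smooth_I hX'
    simp only [obataBracket, TangentEndo.act_add, mlieBracket_add_left hX hX', mlieBracket_add_left hIX hIX',
      map_add]
    module

/-- The connection `∇_X Y = ½ ([X, Y] + I[IX, Y] - J[X, JY] + K[IX, JY])`. -/
def obataConnection :
    CovariantDerivative 𝓘(ℝ, E) E (TangentSpace 𝓘(ℝ, E) : M → Type _) where
  toFun Y x := TensorialAt.mkHom (h.obataBracket · Y x) x (h.tensorialAt_obataBracket Y x)
  isCovariantDerivativeOnUniv :=
    { add := by
        intro Y Y' x hY hY' _
        ext v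
        have hJY := mdiffAt_act h.smooth_J hY
        have hJY' := mdiffAt_act h.smooth_J hY'
        simp only [TensorialAt.mkHom_apply_eq_extend, add_apply]
        simp only [obataBracket, TangentEndo.act_add, mlieBracket_add_right hY hY',
          mlieBracket_add_right hJY hJY', map_add]
        module
      leibniz := by
        intro Y f x hY hf _
        ext v
        have hJY := mdiffAt_act h.smooth_J hY
        simp only [TensorialAt.mkHom_apply_eq_extend, add_apply,
          smul_apply, ContinuousLinearMap.smulRight_apply]
        simp only [obataBracket, TangentEndo.act_smul, mlieBracket_smul_right hf hY,
          mlieBracket_smul_right hf hJY, map_add, map_smul]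
        simp only [TangentEndo.act, h.J_sq, h.KJ, FiberBundle.extend_apply_self]
        module }

lemma obataConnection_apply (X Y : TangentField E M) (x : M) (hX : MDiffAt (T% X) x) :
    h.obataConnection Y x (X x) = h.obataBracket X Y x :=
  TensorialAt.mkHom_apply (h.tensorialAt_obataBracket Y x) hX

/-- `D` is the Obata connection of the hypercomplex structure: it is torsion-free and preserves
`I`, `J`, `K`. -/
structure IsObataConnection
    (D : CovariantDerivative 𝓘(ℝ, E) E (TangentSpace 𝓘(ℝ, E) : M → Type _)) : Prop where
  torsion_eq_zero : D.torsion = 0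
  preserves_I : h.I.IsPreservedBy D
  preserves_J : h.J.IsPreservedBy D
  preserves_K : h.K.IsPreservedBy D

/-- The Obata connection exists. -/
theorem isObataConnection_obataConnection : h.IsObataConnection h.obataConnection := by
  have pI : h.I.IsPreservedBy h.obataConnection := by
    intro Y x hY v
    obtain ⟨X, hX, rfl⟩ : ∃ X : TangentField E M, MDiffAt (T% X) x ∧ X x = v :=
      ⟨FiberBundle.extend E v, FiberBundle.mdifferentiableAt_extend .., by simp⟩
    have hJY := mdiffAt_act h.smooth_J hY
    rw [h.obataConnection_apply _ _ _ hX, h.obataConnection_apply _ _ _ hX]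
    have n1 := congrArg (h.I x) (h.integrable_I X Y x hX hY)
    have n2 := congrArg (h.K x) (h.integrable_I X _ x hX hJY)
    have e1 : h.J.act (h.I.act Y) = -h.K.act Y := by
      funext y; simp [TangentEndo.act, h.JI]
    have e2 : h.I.act (h.J.act Y) = h.K.act Y := by
      funext y; simp [TangentEndo.act, h.IJ]
    have e3 (Z : TangentField E M) : mlieBracket 𝓘(ℝ, E) Z (-h.K.act Y) x =
        -mlieBracket 𝓘(ℝ, E) Z (h.K.act Y) x := by
      have : -h.K.act Y = (fun _ : M ↦ (-1 : ℝ)) • h.K.act Y := by funext y; simp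
      rw [this, mlieBracket_smul_right mdifferentiableAt_const (mdiffAt_act h.smooth_K hY),
        mvfderiv_const]
      simp
    rw [e2] at n2
    simp only [obataBracket, e1, e3, map_sub, map_add, map_neg, map_zero, map_smul, h.I_sq, h.IJ,
      h.IK, h.KI] at n1 n2 ⊢
    linear_combination (norm := module) (1 / 2 : ℝ) • n1 - (1 / 2 : ℝ) • n2
  have pJ : h.J.IsPreservedBy h.obataConnection := by
    intro Y x hY v
    obtain ⟨X, hX, rfl⟩ : ∃ X : TangentField E M, MDiffAt (T% X) x ∧ X x = v :=
      ⟨FiberBundle.extend E v, FiberBundle.mdifferentiableAt_extend .., by simp⟩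
    rw [h.obataConnection_apply _ _ _ hX, h.obataConnection_apply _ _ _ hX]
    have e1 : h.J.act (h.J.act Y) = -Y := by
      funext y; simp [TangentEndo.act, h.J_sq]
    have e3 (Z : TangentField E M) : mlieBracket 𝓘(ℝ, E) Z (-Y) x =
        -mlieBracket 𝓘(ℝ, E) Z Y x := by
      have : -Y = (fun _ : M ↦ (-1 : ℝ)) • Y := by funext y; simp
      rw [this, mlieBracket_smul_right mdifferentiableAt_const hY, mvfderiv_const]
      simp
    simp only [obataBracket, e1, e3, map_sub, map_add, map_neg, map_smul, h.J_sq, h.JI, h.JK]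
    module
  refine ⟨?_, pI, pJ, ?_⟩
  · rw [CovariantDerivative.torsion_eq_zero_iff]
    intro X Y x hX hY
    have hIX := mdiffAt_act h.smooth_I hX
    have hIY := mdiffAt_act h.smooth_I hY
    rw [h.obataConnection_apply _ _ _ hX, h.obataConnection_apply _ _ _ hY]
    have n1 := h.integrable_I X Y x hX hY
    have n2 := h.integrable_J X Y x hX hY
    have n3 := h.integrable_K _ _ x hIX hIY
    have e (Z : TangentField E M) : h.K.act (h.I.act Z) = h.J.act Z := by
      funext y; simp [TangentEndo.act, h.KI]
    rw [e, e] at n3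
    simp only [obataBracket]
    rw [mlieBracket_swap_apply (V := Y) (W := X), mlieBracket_swap_apply (V := h.I.act Y) (W := X),
      mlieBracket_swap_apply (V := Y) (W := h.J.act X),
      mlieBracket_swap_apply (V := h.I.act Y) (W := h.J.act X)]
    simp only [map_neg]
    linear_combination (norm := module) (-1 / 2 : ℝ) • n1 + (1 / 2 : ℝ) • n2 - (1 / 2 : ℝ) • n3
  · intro Y x hY v
    have hJY := mdiffAt_act h.smooth_J hY
    have e : h.K.act Y = h.I.act (h.J.act Y) := by
      funext y; simp [TangentEndo.act, h.IJ]
    rw [e, pI _ x hJY, pJ _ x hY, h.IJ]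

end HypercomplexStructure

end Structures

section Forms

/-! ### Complex-valued differential forms -/

/-- The value `α_ℂ(a₁ + √-1 b₁, …, a_k + √-1 b_k)` of the complex-multilinear extension `α_ℂ` to
`V ⊗ ℂ` of a real-multilinear complex-valued form `α` on `V`. -/
def complexEval {V : Type*} [AddCommGroup V] [Module ℝ V] [TopologicalSpace V] {k : ℕ}
    (α : V [⋀^Fin k]→L[ℝ] ℂ) (a b : Fin k → V) : ℂ :=
  ∑ S : Finset (Fin k), Complex.I ^ S.card * α (fun j ↦ if j ∈ S then b j else a j)

/-- The component of type `(p, k - p)`, with respect to the complex structure `A` on `V`, of a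
`k`-form `α`: the sum over all `p`-element sets `S` of slots of `α_ℂ` evaluated at the
`(1,0)`-parts `½ (v - √-1 A v)` of the vectors in the slots of `S`, and at the `(0,1)`-parts
`½ (v + √-1 A v)` of the vectors in the other slots. -/
def typeComponent {V : Type*} [AddCommGroup V] [Module ℝ V] [TopologicalSpace V] {k : ℕ}
    (A : V →L[ℝ] V) (p : ℕ) (α : V [⋀^Fin k]→L[ℝ] ℂ) (v : Fin k → V) : ℂ :=
  (1 / 2 : ℂ) ^ k * ∑ S ∈ Finset.powersetCard p (Finset.univ : Finset (Fin k)),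
    complexEval α v (fun j ↦ if j ∈ S then -A (v j) else A (v j))

variable (E : Type*) [NormedAddCommGroup E] [NormedSpace ℝ E]
  (M : Type*) [TopologicalSpace M] [ChartedSpace E M]

/-- A (not necessarily smooth) complex-valued differential `k`-form on `M`. -/
abbrev ComplexForm (k : ℕ) : Type _ := Π x : M, TangentSpace 𝓘(ℝ, E) x [⋀^Fin k]→L[ℝ] ℂ

variable {E M} {k : ℕ}

namespace ComplexForm

/-- The expression of a form in the chart at `x₀`: its pullback under the inverse of the chart. -/
def inChart (η : ComplexForm E M k) (x₀ : M) : E → E [⋀^Fin k]→L[ℝ] ℂ :=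
  fun y ↦ (η ((extChartAt 𝓘(ℝ, E) x₀).symm y)).compContinuousLinearMap
    (mfderiv 𝓘(ℝ, E) 𝓘(ℝ, E) (extChartAt 𝓘(ℝ, E) x₀).symm y)

/-- The form is smooth in every chart. -/
def IsSmooth (η : ComplexForm E M k) : Prop :=
  ∀ x₀ : M, ContDiffOn ℝ ∞ (η.inChart x₀) (extChartAt 𝓘(ℝ, E) x₀).target

/-- The exterior derivative, computed at `x` in the chart at `x`. -/
def d (η : ComplexForm E M k) : ComplexForm E M (k + 1) :=
  fun x ↦ (extDeriv (η.inChart x) (extChartAt 𝓘(ℝ, E) x x)).compContinuousLinearMap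
    (mfderiv 𝓘(ℝ, E) 𝓘(ℝ, E) (extChartAt 𝓘(ℝ, E) x) x)

/-- `η` is of Hodge type `(p, k - p)` with respect to `A`. -/
def HasType (A : TangentEndo E M) (p : ℕ) (η : ComplexForm E M k) : Prop :=
  ∀ (x : M) (v : Fin k → TangentSpace 𝓘(ℝ, E) x), typeComponent (A x) p (η x) v = η x v

/-- The value at `x` and `v` of `∂̄η`, for a form `η` of type `(p, k - p)` with respect to the
complex structure `A`: the component of type `(p, k + 1 - p)` of `dη`. -/
def dbar (A : TangentEndo E M) (p : ℕ) (η : ComplexForm E M k) (x : M)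
    (v : Fin (k + 1) → TangentSpace 𝓘(ℝ, E) x) : ℂ :=
  typeComponent (A x) p (η.d x) v

/-- `η` is a holomorphic `k`-form on the complex manifold `(M, A)`: a smooth form of type `(k, 0)`
with `∂̄η = 0`. -/
structure IsHolomorphic (A : TangentEndo E M) (η : ComplexForm E M k) : Prop where
  smooth : η.IsSmooth
  hasType : η.HasType A k
  dbar_eq_zero : ∀ x v, η.dbar A k x v = 0

/-- `ℍ`-reality, `J(η̄) = η`, where `J` acts multiplicatively on forms:
`(Jα)(v₁, …, v_k) = α(J v₁, …, J v_k)`. It is used in even degree `k`, where the other usual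
convention `α(J⁻¹ v₁, …, J⁻¹ v_k)` gives the same. -/
def IsHReal [IsManifold 𝓘(ℝ, E) ∞ M] (h : HypercomplexStructure E M)
    (η : ComplexForm E M k) : Prop :=
  ∀ (x : M) (v : Fin k → TangentSpace 𝓘(ℝ, E) x),
    (starRingEnd ℂ) (η x (fun j ↦ h.J x (v j))) = η x v

variable [IsManifold 𝓘(ℝ, E) ∞ M]

/-- The covariant derivative of a form, evaluated at `v ∈ T_xM` and at vector fields `X₁, …, X_k`:
`(∇_v η)(X₁, …, X_k) = v(η(X₁, …, X_k)) - ∑ᵢ η(X₁, …, ∇_v Xᵢ, …, X_k)`. -/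
def covDeriv (D : CovariantDerivative 𝓘(ℝ, E) E (TangentSpace 𝓘(ℝ, E) : M → Type _))
    (η : ComplexForm E M k) (x : M) (v : TangentSpace 𝓘(ℝ, E) x)
    (X : Fin k → TangentField E M) : ℂ :=
  mvfderiv 𝓘(ℝ, E) (fun y ↦ η y (fun j ↦ X j y)) x v
    - ∑ i, η x (Function.update (fun j ↦ X j x) i (D (X i) x v))

/-- `η` is parallel for the connection `D`: `∇η = 0`. -/
def IsParallel (D : CovariantDerivative 𝓘(ℝ, E) E (TangentSpace 𝓘(ℝ, E) : M → Type _))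
    (η : ComplexForm E M k) : Prop :=
  ∀ (x : M) (v : TangentSpace 𝓘(ℝ, E) x) (X : Fin k → TangentField E M),
    (∀ j, MDiffAt (T% (X j)) x) → η.covDeriv D x v X = 0

end ComplexForm

end Forms

end

/-! Let `η` be of degree `k`. Since `∇I = 0`, each `∇_v η` is again of type `(k, 0)`, so it is
complex-linear in every slot (`covDerivAt_update`). Since `∇` is torsion-free, `dη` is the
alternation of `∇η` (`d_apply_eq_sum_covDerivAt`). Hence `∂̄η` is the image of the `(0, 1)`-part of
`∇η` under the wedge map `Λ^{0,1} ⊗ Λ^{k,0} → Λ^{k,1}`. This map is injective, so `∂̄η = 0` gives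
`∇_v η + √-1 ∇_{Iv} η = 0` (`add_I_mul_eq_zero_of_typeComponent_eq_zero`).

Since `∇J = 0`, the antilinear operator `α ↦ J(ᾱ)` commutes with each `∇_v` for real `v`, so `∇_v η`
is `ℍ`-real along with `η` (`conj_covDerivAt`). Applying the operator to the equation above gives
`∇_v η - √-1 ∇_{Iv} η = 0`. The two equations add up to `2 ∇_v η = 0`. -/

noncomputable section

/-! ### Type decomposition of forms on one vector space -/

section LinearAlgebra

variable {V : Type*} {k : ℕ}

/-- The value at `a + √-1 b` of the complex-multilinear extension of `f`. -/
def complexExtension (f : (Fin k → V) → ℂ) (a b : Fin k → V) : ℂ :=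
  ∑ S : Finset (Fin k), Complex.I ^ S.card * f (fun j ↦ if j ∈ S then b j else a j)

/-- Pairing each `S` not containing `l` with `S ∪ {l}` isolates slot `l`, which then carries `a l +
√-1 b l`. -/
lemma complexExtension_eq_sum_erase (f : (Fin k → V) → ℂ) (a b : Fin k → V) (l : Fin k) :
    complexExtension f a b = ∑ S ∈ (Finset.univ.erase l).powerset, Complex.I ^ S.card *
      (f (fun j ↦ if j ∈ S then b j else a j) +
        Complex.I * f (Function.update (fun j ↦ if j ∈ S then b j else a j) l (b l))) := by
  have h : (Finset.univ : Finset (Finset (Fin k))) =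
      (insert l (Finset.univ.erase l)).powerset := by
    rw [Finset.insert_erase (Finset.mem_univ l), Finset.powerset_univ]
  rw [complexExtension, h, Finset.sum_powerset_insert (Finset.notMem_erase _ _),
    ← Finset.sum_add_distrib]
  refine Finset.sum_congr rfl fun S hS ↦ ?_
  have hl : l ∉ S := fun hl ↦ by simpa using Finset.mem_powerset.1 hS hl
  have e : (fun j ↦ if j ∈ insert l S then b j else a j) =
      Function.update (fun j ↦ if j ∈ S then b j else a j) l (b l) := by
    funext j
    rcases eq_or_ne j l with rfl | hj <;> simp [*]
  rw [e, Finset.card_insert_of_notMem hl, pow_succ]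
  ring

/-- The model case is `b l = A (a l)`: slot `l` then carries a vector of type `(0, 1)`, which a
complex-linear slot kills. -/
lemma complexExtension_eq_zero {f : (Fin k → V) → ℂ} {a b : Fin k → V} (l : Fin k)
    (hf : ∀ u, f (Function.update u l (b l)) = Complex.I * f (Function.update u l (a l))) :
    complexExtension f a b = 0 := by
  rw [complexExtension_eq_sum_erase f a b l]
  refine Finset.sum_eq_zero fun S hS ↦ ?_
  have hl : l ∉ S := fun hl ↦ by simpa using Finset.mem_powerset.1 hS hl
  have e : Function.update (fun j ↦ if j ∈ S then b j else a j) l (a l) =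
      (fun j ↦ if j ∈ S then b j else a j) := by
    rw [Function.update_eq_self_iff]; simp [hl]
  rw [hf, e, ← mul_assoc, Complex.I_mul_I]
  ring

/-- Each replacement of `a l` by `b l` costs a factor `-√-1`, which cancels one factor `√-1`. -/
lemma I_pow_mul_apply_ite {f : (Fin k → V) → ℂ} {b : Fin k → V} (S : Finset (Fin k))
    {a : Fin k → V} (hf : ∀ l ∈ S, ∀ u, f (Function.update u l (b l)) =
      -Complex.I * f (Function.update u l (a l))) :
    Complex.I ^ S.card * f (fun j ↦ if j ∈ S then b j else a j) = f a := by
  induction S using Finset.induction_on with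
  | empty => simp
  | insert l S hl ih =>
    have e : (fun j ↦ if j ∈ insert l S then b j else a j) =
        Function.update (fun j ↦ if j ∈ S then b j else a j) l (b l) := by
      funext j
      rcases eq_or_ne j l with rfl | hj <;> simp [*]
    have e' : Function.update (fun j ↦ if j ∈ S then b j else a j) l (a l) =
        (fun j ↦ if j ∈ S then b j else a j) := by
      rw [Function.update_eq_self_iff]; simp [hl]
    rw [← ih fun m hm ↦ hf m (Finset.mem_insert_of_mem hm), e,
      hf l (Finset.mem_insert_self _ _), e', Finset.card_insert_of_notMem hl, pow_succ]
    linear_combination -(Complex.I ^ S.card * f (fun j ↦ if j ∈ S then b j else a j)) *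
      Complex.I_mul_I

/-- For `f`, replacing `a l` by `b l` amounts to the factor `-√-1` when `l ≠ j`, so `a l + √-1 b l`
counts as `2 a l`. The `k - 1` such slots give the power of two. -/
lemma complexExtension_eq_two_pow_mul {f : (Fin k → V) → ℂ} {a b : Fin k → V} (j : Fin k)
    (hf : ∀ l ≠ j, ∀ u, f (Function.update u l (b l)) =
      -Complex.I * f (Function.update u l (a l))) :
    complexExtension f a b =
      2 ^ (k - 1) * (f a + Complex.I * f (Function.update a j (b j))) := by
  have hc : ((Finset.univ.erase j).powerset).card = 2 ^ (k - 1) := by simp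
  rw [complexExtension_eq_sum_erase f a b j, Finset.sum_congr rfl (g := fun _ ↦
      f a + Complex.I * f (Function.update a j (b j))), Finset.sum_const, hc, nsmul_eq_mul]
  · push_cast; rfl
  intro S hS
  have hne : ∀ l ∈ S, l ≠ j := fun l hl ↦ by simpa using Finset.mem_powerset.1 hS hl
  have hj : j ∉ S := fun hj ↦ hne j hj rfl
  have h1 := I_pow_mul_apply_ite S (a := a) fun l hl ↦ hf l (hne l hl)
  have h2 := I_pow_mul_apply_ite S (a := Function.update a j (b j)) (b := b) (f := f)
    fun l hl u ↦ by rw [Function.update_of_ne (hne l hl)]; exact hf l (hne l hl) u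
  have e : Function.update (fun l ↦ if l ∈ S then b l else a l) j (b j) =
      (fun l ↦ if l ∈ S then b l else Function.update a j (b j) l) := by
    funext l
    rcases eq_or_ne l j with rfl | hl <;> simp [*]
  rw [e, mul_add, h1, ← h2]
  ring

lemma powersetCard_univ_eq_image_compl_singleton :
    Finset.powersetCard k (Finset.univ : Finset (Fin (k + 1))) =
      Finset.univ.image fun m : Fin (k + 1) ↦ ({m}ᶜ : Finset (Fin (k + 1))) := by
  ext S
  simp only [Finset.mem_powersetCard, Finset.subset_univ, true_and, Finset.mem_image,
    Finset.mem_univ]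
  constructor
  · intro h
    have : Sᶜ.card = 1 := by rw [Finset.card_compl, h, Fintype.card_fin]; simp
    obtain ⟨m, hm⟩ := Finset.card_eq_one.1 this
    exact ⟨m, by rw [← hm, compl_compl]⟩
  · rintro ⟨m, rfl⟩
    simp [Finset.card_compl]

variable [AddCommGroup V] [Module ℝ V] [TopologicalSpace V] {A : V →L[ℝ] V}

/-- A form of type `(k, 0)` is complex-linear in each slot. -/
lemma apply_update_of_typeComponent_eq (hA : ∀ v, A (A v) = -v) {α : V [⋀^Fin k]→L[ℝ] ℂ}
    (hα : ∀ v, typeComponent A k α v = α v) (v : Fin k → V) (l : Fin k) :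
    α (Function.update v l (A (v l))) = Complex.I * α v := by
  have key (w : Fin k → V) : α w = (1 / 2 : ℂ) ^ k * complexExtension α w (fun j ↦ -A (w j)) := by
    have hs : Finset.powersetCard k (Finset.univ : Finset (Fin k)) = {Finset.univ} := by
      simpa using Finset.powersetCard_self (Finset.univ : Finset (Fin k))
    rw [← hα, typeComponent, hs, Finset.sum_singleton]
    simp [complexEval, complexExtension]
  have hneg (u : Fin k → V) (x : V) :
      α (Function.update u l (-x)) = -α (Function.update u l x) :=
    α.toMultilinearMap.map_update_neg u l x
  -- By `key`, slot `l` only sees `v l - √-1 A (v l)`. Putting `A (v l)` for `v l` turns this into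
  -- `A (v l) + √-1 v l`, which is `√-1` times the original.
  rw [key, key v, complexExtension_eq_sum_erase _ _ _ l, complexExtension_eq_sum_erase _ v _ l,
    mul_left_comm]
  congr 1
  rw [Finset.mul_sum]
  refine Finset.sum_congr rfl fun S hS ↦ ?_
  have hl : l ∉ S := fun hl ↦ by simpa using Finset.mem_powerset.1 hS hl
  set p : Fin k → V := fun j ↦ if j ∈ S then -A (v j) else v j with hp
  have e : (fun j ↦ if j ∈ S then -A (Function.update v l (A (v l)) j)
      else Function.update v l (A (v l)) j) = Function.update p l (A (v l)) := by
    funext j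
    rcases eq_or_ne j l with rfl | hj <;> simp [*]
  have e' : Function.update p l (v l) = p := by
    rw [Function.update_eq_self_iff]; simp [hp, hl]
  simp only [e, Function.update_self, Function.update_idem, hA, neg_neg, e',
    hneg]
  linear_combination (Complex.I ^ S.card * α (Function.update p l (A (v l)))) * Complex.I_mul_I

/-- If the alternation of `F`, of type `(k, 0)` in its last `k` slots, has no `(k, 1)`-part, then
`F` vanishes on vectors of type `(0, 1)` in its first slot. -/
lemma add_I_mul_eq_zero_of_typeComponent_eq_zero (hA : ∀ v, A (A v) = -v)
    {F : V → (Fin k → V) → ℂ} (hneg : ∀ v w, F (-v) w = -F v w)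
    (hF : ∀ v w l, F v (Function.update w l (A (w l))) = Complex.I * F v w)
    {β : V [⋀^Fin (k + 1)]→L[ℝ] ℂ}
    (hβ : ∀ v, β v = ∑ j : Fin (k + 1), (-1) ^ (j : ℕ) * F (v j) (j.removeNth v))
    (h0 : ∀ v, typeComponent A k β v = 0) (v : V) (w : Fin k → V) :
    F v w + Complex.I * F (A v) w = 0 := by
  have hF' (v : V) (w : Fin k → V) (l : Fin k) :
      F v (Function.update w l (-A (w l))) = -Complex.I * F v w := by
    have := hF v (Function.update w l (-A (w l))) l
    simp only [Function.update_self, Function.update_idem, map_neg, hA, neg_neg,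
      Function.update_eq_self] at this
    rw [this]
    linear_combination F v (Function.update w l (-A (w l))) * Complex.I_mul_I
  have hrem (j : Fin (k + 1)) (l : Fin k) (u : Fin (k + 1) → V) (x : V) :
      j.removeNth (Function.update u (j.succAbove l) x) =
        Function.update (j.removeNth u) l x := by
    funext i
    rcases eq_or_ne i l with rfl | hi
    · simp [Fin.removeNth]
    · simp [Fin.removeNth, hi]
  -- Up to a nonzero constant, the `(k, 1)`-part of `β` is the alternating sum of `Φ(v, w) = F(v, w)
  -- + √-1 F(Av, w)`.
  have hsum (v : Fin (k + 1) → V) : ∑ j : Fin (k + 1), (-1) ^ (j : ℕ) *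
      (F (v j) (j.removeNth v) + Complex.I * F (A (v j)) (j.removeNth v)) = 0 := by
    have h := h0 v
    rw [typeComponent, mul_eq_zero, or_iff_right (pow_ne_zero _ (by norm_num)),
      powersetCard_univ_eq_image_compl_singleton, Finset.sum_image
        fun _ _ _ _ h ↦ Finset.singleton_injective (compl_injective h)] at h
    have hterm (m : Fin (k + 1)) : complexEval β v
        (fun j ↦ if j ∈ ({m}ᶜ : Finset (Fin (k + 1))) then -A (v j) else A (v j)) =
        2 ^ k * ((-1) ^ (m : ℕ) *
          (F (v m) (m.removeNth v) + Complex.I * F (A (v m)) (m.removeNth v))) := by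
      set b : Fin (k + 1) → V :=
        fun j ↦ if j ∈ ({m}ᶜ : Finset (Fin (k + 1))) then -A (v j) else A (v j) with hb
      have hbm : b m = A (v m) := by simp [hb]
      have hbn {l} (hl : l ≠ m) : b l = -A (v l) := by simp [hb, hl]
      have hexp : complexEval β v b = ∑ j : Fin (k + 1), (-1) ^ (j : ℕ) *
          complexExtension (fun u ↦ F (u j) (j.removeNth u)) v b := by
        simp only [complexEval, complexExtension, hβ, Finset.mul_sum]
        rw [Finset.sum_comm]
        exact Finset.sum_congr rfl fun _ _ ↦ Finset.sum_congr rfl fun _ _ ↦ mul_left_comm _ _ _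
      -- Slot `m` carries the only vector of type `(0, 1)`. For `j ≠ m` it is fed into a
      -- complex-linear slot of `F`, so only `j = m` survives.
      rw [hexp, Finset.sum_eq_single m]
      · rw [complexExtension_eq_two_pow_mul m, hbm]
        · simp
          ring
        · intro l hl u
          obtain ⟨i, rfl⟩ := Fin.exists_succAbove_eq hl
          simp only [hbn hl, hrem, Function.update_of_ne hl.symm]
          simpa using hF' (u m) (Function.update (m.removeNth u) i (v (m.succAbove i))) i
      · intro j _ hj
        rw [complexExtension_eq_zero m, mul_zero]
        intro u
        obtain ⟨i, rfl⟩ := Fin.exists_succAbove_eq hj.symm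
        simp only [hbm, hrem, Function.update_of_ne hj]
        simpa using hF (u j) (Function.update (j.removeNth u) i (v (j.succAbove i))) i
      · simp
    simp only [hterm, ← Finset.mul_sum] at h
    simpa using h
  -- Injectivity of the wedge map: replacing `v` by `Av` multiplies the term `j = 0`, which is `Φ(v,
  -- w)`, by `-√-1`, and all other terms by `√-1`, as there `v` sits in a complex-linear slot. Thus
  -- `Φ + R = 0` and `-√-1 Φ + √-1 R = 0`, where `R` is the sum of those terms, and so `Φ = 0`.
  set u : Fin (k + 1) → V := Fin.cons v w with hu
  have h1 := hsum u
  have h2 := hsum (Function.update u 0 (A v))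
  rw [← Finset.add_sum_erase _ _ (Finset.mem_univ 0)] at h1 h2
  have hu0 (x : V) : (0 : Fin (k + 1)).removeNth (Function.update u 0 x) = w := by
    funext i; simp [Fin.removeNth, hu]
  have hrest : ∑ j ∈ Finset.univ.erase (0 : Fin (k + 1)), (-1) ^ (j : ℕ) *
      (F (Function.update u 0 (A v) j) (j.removeNth (Function.update u 0 (A v))) +
        Complex.I * F (A (Function.update u 0 (A v) j))
          (j.removeNth (Function.update u 0 (A v)))) =
      Complex.I * ∑ j ∈ Finset.univ.erase (0 : Fin (k + 1)), (-1) ^ (j : ℕ) *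
        (F (u j) (j.removeNth u) + Complex.I * F (A (u j)) (j.removeNth u)) := by
    rw [Finset.mul_sum]
    refine Finset.sum_congr rfl fun j hj ↦ ?_
    have hj0 : j ≠ 0 := by simpa using hj
    obtain ⟨i, hi⟩ := Fin.exists_succAbove_eq hj0.symm
    have hv : A v = A (j.removeNth u i) := by simp [Fin.removeNth, hi, hu]
    have e : j.removeNth (Function.update u 0 (A v)) =
        Function.update (j.removeNth u) i (A (j.removeNth u i)) := by
      rw [← hi, hrem, hv]
    rw [e, hF, hF, Function.update_of_ne hj0]
    ring
  have hw : (0 : Fin (k + 1)).removeNth u = w := by simp [hu]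
  have huv : u 0 = v := rfl
  rw [hrest, hu0, Function.update_self, hA, hneg] at h2
  rw [hw, huv] at h1
  simp only [Fin.val_zero, pow_zero, one_mul] at h1 h2
  linear_combination (1 / 2 : ℂ) * h1 + (Complex.I / 2) * h2 -
    (1 / 2 : ℂ) * (-F v w + (∑ j ∈ Finset.univ.erase (0 : Fin (k + 1)), (-1) ^ (j : ℕ) *
      (F (u j) (j.removeNth u) + Complex.I * F (A (u j)) (j.removeNth u)))) * Complex.I_mul_I

end LinearAlgebra

/-! ### Forms and vector fields in the preferred chart -/

section Coordinates

open scoped Topology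

variable {E : Type*} [NormedAddCommGroup E] [NormedSpace ℝ E]
  {M : Type*} [TopologicalSpace M] [ChartedSpace E M] {k : ℕ} {x : M}

lemma ComplexForm.IsSmooth.differentiableAt_inChart {η : ComplexForm E M k} (hη : η.IsSmooth) (x : M) :
    DifferentiableAt ℝ (η.inChart x) (extChartAt 𝓘(ℝ, E) x x) :=
  ((hη x).contDiffAt (extChartAt_target_mem_nhds x)).differentiableAt (by simp)

lemma mvfderiv_clm_comp (L : ℂ →L[ℝ] ℂ) {g : M → ℂ} (hg : MDifferentiableAt 𝓘(ℝ, E) 𝓘(ℝ, ℂ) g x)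
    (v : TangentSpace 𝓘(ℝ, E) x) :
    mvfderiv 𝓘(ℝ, E) (fun y ↦ L (g y)) x v = L (mvfderiv 𝓘(ℝ, E) g x v) := by
  have h := (L.hasMFDerivAt.comp x hg.hasMFDerivAt).mfderiv
  exact congr($h v)

variable [IsManifold 𝓘(ℝ, E) ∞ M]

/-- The components of the vector field `X` in the chart at `x`. -/
def chartComponents (x : M) (X : TangentField E M) (y : M) : E :=
  mfderiv 𝓘(ℝ, E) 𝓘(ℝ, E) (extChartAt 𝓘(ℝ, E) x) y (X y)

/-- The tangent space at `x` is identified with `E` through the preferred chart at `x` itself. -/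
lemma mfderiv_extChartAt_self_apply (v : TangentSpace 𝓘(ℝ, E) x) :
    mfderiv 𝓘(ℝ, E) 𝓘(ℝ, E) (extChartAt 𝓘(ℝ, E) x) x v = v := by
  have : IsManifold 𝓘(ℝ, E) 1 M := .of_le (n := ∞) (by simp)
  rw [mfderiv_extChartAt_self]
  rfl

lemma chartComponents_self (X : TangentField E M) : chartComponents x X x = X x :=
  mfderiv_extChartAt_self_apply _

lemma trivializationAt_snd_eq_chartComponents {X : TangentField E M} {y : M}
    (hy : y ∈ (chartAt E x).source) :
    (trivializationAt E (TangentSpace 𝓘(ℝ, E)) x ⟨y, X y⟩).2 = chartComponents x X y := by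
  have : IsManifold 𝓘(ℝ, E) 1 M := .of_le (n := ∞) (by simp)
  have h1 := congr($(TangentBundle.continuousLinearMapAt_trivializationAt (I := 𝓘(ℝ, E)) hy) (X y))
  refine Eq.trans ?_ h1
  rw [Trivialization.continuousLinearMapAt_apply, Trivialization.linearMapAt_apply,
    if_pos (by simpa)]

lemma mdifferentiableAt_chartComponents {X : TangentField E M} (hX : MDiffAt (T% X) x) :
    MDifferentiableAt 𝓘(ℝ, E) 𝓘(ℝ, E) (chartComponents x X) x := by
  rw [mdifferentiableAt_section] at hX
  refine hX.congr_of_eventuallyEq ?_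
  filter_upwards [(chartAt E x).open_source.mem_nhds (mem_chart_source E x)] with y hy
  exact (trivializationAt_snd_eq_chartComponents hy).symm

/-- `FiberBundle.extend` is constant in the trivialization at `x`, so on the chart domain it is a
coordinate field with constant coefficients. -/
lemma chartComponents_extend {v : TangentSpace 𝓘(ℝ, E) x} {y : M}
    (hy : y ∈ (chartAt E x).source) : chartComponents x (FiberBundle.extend E v) y = v := by
  have hv : (trivializationAt E (TangentSpace 𝓘(ℝ, E)) x ⟨x, v⟩).2 = v := by
    have := trivializationAt_snd_eq_chartComponents (X := FiberBundle.extend E v)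
      (mem_chart_source E x)
    rwa [chartComponents_self, FiberBundle.extend_apply_self] at this
  have h (w : E) : (trivializationAt E (TangentSpace 𝓘(ℝ, E)) x
      ⟨y, (trivializationAt E (TangentSpace 𝓘(ℝ, E)) x).symm y w⟩).2 = w := by
    rw [Trivialization.apply_mk_symm _ (by simpa)]
  rw [← trivializationAt_snd_eq_chartComponents hy, FiberBundle.extend]
  exact (h _).trans hv

lemma mfderiv_extChartAt_symm_chartComponents {X : TangentField E M} {z : E}
    (hz : z ∈ (extChartAt 𝓘(ℝ, E) x).target) :
    (mfderiv 𝓘(ℝ, E) 𝓘(ℝ, E) (extChartAt 𝓘(ℝ, E) x).symm z)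
      (chartComponents x X ((extChartAt 𝓘(ℝ, E) x).symm z) : E) =
        X ((extChartAt 𝓘(ℝ, E) x).symm z) := by
  have : IsManifold 𝓘(ℝ, E) 1 M := .of_le (n := ∞) (by simp)
  have h := mfderivWithin_extChartAt_symm_comp_mfderiv_extChartAt (I := 𝓘(ℝ, E)) hz
  rw [ModelWithCorners.range_eq_univ, mfderivWithin_univ] at h
  exact congr($h (X _))

/-- Coordinate vector fields commute. -/
lemma mlieBracket_extend_extend (v w : TangentSpace 𝓘(ℝ, E) x) :
    mlieBracket 𝓘(ℝ, E) (FiberBundle.extend E v : TangentField E M) (FiberBundle.extend E w) x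
      = 0 := by
  have : IsManifold 𝓘(ℝ, E) 1 M := .of_le (n := ∞) (by simp)
  have hconst (a b z : E) : lieBracket ℝ (fun _ ↦ a) (fun _ ↦ b) z = 0 := by simp [lieBracket]
  have key (u : TangentSpace 𝓘(ℝ, E) x) :
      mpullbackWithin 𝓘(ℝ, E) 𝓘(ℝ, E) (extChartAt 𝓘(ℝ, E) x).symm
        (FiberBundle.extend E u : TangentField E M) Set.univ
        =ᶠ[𝓝 (extChartAt 𝓘(ℝ, E) x x)] fun _ ↦ u := by
    filter_upwards [extChartAt_target_mem_nhds (I := 𝓘(ℝ, E)) x] with z hz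
    have h1 := mfderiv_extChartAt_symm_chartComponents
      (X := (FiberBundle.extend E u : TangentField E M)) hz
    rw [chartComponents_extend (by simpa using (extChartAt 𝓘(ℝ, E) x).map_target hz)] at h1
    rw [mpullbackWithin_apply, ← h1, mfderivWithin_univ]
    have hinv := isInvertible_mfderivWithin_extChartAt_symm hz
    rw [ModelWithCorners.range_eq_univ, mfderivWithin_univ] at hinv
    exact hinv.inverse_apply_eq.2 rfl
  rw [← mlieBracketWithin_univ, mlieBracketWithin_apply, ModelWithCorners.range_eq_univ]
  rw [Set.preimage_univ, Set.univ_inter]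
  have h0 : lieBracketWithin ℝ
      (mpullbackWithin 𝓘(ℝ, E) 𝓘(ℝ, E) (extChartAt 𝓘(ℝ, E) x).symm
        (FiberBundle.extend E v : TangentField E M) Set.univ)
      (mpullbackWithin 𝓘(ℝ, E) 𝓘(ℝ, E) (extChartAt 𝓘(ℝ, E) x).symm
        (FiberBundle.extend E w : TangentField E M) Set.univ) Set.univ
      (extChartAt 𝓘(ℝ, E) x x) = 0 := by
    refine (congr($lieBracketWithin_univ _)).trans
      ((Filter.EventuallyEq.lieBracket_vectorField_eq (key v) (key w)).trans (hconst _ _ _))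
  exact (congrArg _ h0).trans (map_zero _)

namespace ComplexForm

variable {η : ComplexForm E M k}

lemma apply_eventuallyEq_inChart (η : ComplexForm E M k) (x : M) (X : Fin k → TangentField E M) :
    (fun y ↦ η y (fun j ↦ X j y)) =ᶠ[𝓝 x] fun y ↦
      η.inChart x (extChartAt 𝓘(ℝ, E) x y) (fun j ↦ chartComponents x (X j) y) := by
  filter_upwards [extChartAt_source_mem_nhds (I := 𝓘(ℝ, E)) x] with y hy
  obtain ⟨z, hz, rfl⟩ : ∃ z ∈ (extChartAt 𝓘(ℝ, E) x).target, (extChartAt 𝓘(ℝ, E) x).symm z = y :=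
    ⟨_, (extChartAt 𝓘(ℝ, E) x).map_source hy, (extChartAt 𝓘(ℝ, E) x).left_inv hy⟩
  rw [(extChartAt 𝓘(ℝ, E) x).right_inv hz]
  exact congrArg (η ((extChartAt 𝓘(ℝ, E) x).symm z)) <| funext fun j ↦
    (mfderiv_extChartAt_symm_chartComponents hz).symm

lemma IsSmooth.mdifferentiableAt_apply (hη : η.IsSmooth) {X : Fin k → TangentField E M}
    (hX : ∀ j, MDiffAt (T% (X j)) x) :
    MDifferentiableAt 𝓘(ℝ, E) 𝓘(ℝ, ℂ) (fun y ↦ η y (fun j ↦ X j y)) x := by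
  have : IsManifold 𝓘(ℝ, E) 1 M := .of_le (n := ∞) (by simp)
  refine MDifferentiableAt.congr_of_eventuallyEq ?_ (apply_eventuallyEq_inChart η x X)
  have h1 : MDifferentiableAt 𝓘(ℝ, E) 𝓘(ℝ, E [⋀^Fin k]→L[ℝ] ℂ)
      (fun y ↦ η.inChart x (extChartAt 𝓘(ℝ, E) x y)) x :=
    (hη.differentiableAt_inChart x).mdifferentiableAt.comp x
      (mdifferentiableAt_extChartAt (mem_chart_source E x))
  have h2 : MDifferentiableAt 𝓘(ℝ, E) 𝓘(ℝ, Fin k → E)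
      (fun y j ↦ chartComponents x (X j) y) x := by
    have h (j : Fin k) :=
      (mdifferentiableAt_iff _ _).1 (mdifferentiableAt_chartComponents (hX j))
    rw [mdifferentiableAt_iff]
    exact ⟨continuousAt_pi.2 fun j ↦ (h j).1, differentiableWithinAt_pi.2 fun j ↦ (h j).2⟩
  have h3 : DifferentiableAt ℝ (fun p : (E [⋀^Fin k]→L[ℝ] ℂ) × (Fin k → E) ↦ p.1 p.2)
      (η.inChart x (extChartAt 𝓘(ℝ, E) x x), fun j ↦ chartComponents x (X j) x) :=
    differentiableAt_fst.continuousAlternatingMap_apply fun j ↦ by fun_prop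
  exact DifferentiableAt.comp_mdifferentiableAt
    (f := fun y ↦ (η.inChart x (extChartAt 𝓘(ℝ, E) x y), fun j ↦ chartComponents x (X j) y))
    h3 (h1.prodMk_space h2)

/-- The arguments have constant components in the chart, so only the coefficients of the form get
differentiated. -/
lemma IsSmooth.mvfderiv_apply_extend (hη : η.IsSmooth) (v : TangentSpace 𝓘(ℝ, E) x)
    (w : Fin k → TangentSpace 𝓘(ℝ, E) x) :
    mvfderiv 𝓘(ℝ, E) (fun y ↦ η y (fun j ↦ FiberBundle.extend E (w j) y)) x v =
      fderiv ℝ (η.inChart x) (extChartAt 𝓘(ℝ, E) x x) v w := by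
  have : IsManifold 𝓘(ℝ, E) 1 M := .of_le (n := ∞) (by simp)
  have h1 : (fun y ↦ η y (fun j ↦ FiberBundle.extend E (w j) y)) =ᶠ[𝓝 x]
      (fun z ↦ η.inChart x z w) ∘ extChartAt 𝓘(ℝ, E) x := by
    filter_upwards [apply_eventuallyEq_inChart η x fun j ↦ FiberBundle.extend E (w j),
      (chartAt E x).open_source.mem_nhds (mem_chart_source E x)] with y hy hy'
    simp only [hy, Function.comp_apply, chartComponents_extend hy']
  have hd := hη.differentiableAt_inChart x
  have h2 := (hd.continuousAlternatingMap_apply_const w).mdifferentiableAt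
  have h3 := (h2.hasMFDerivAt.comp x
    (mdifferentiableAt_extChartAt (I := 𝓘(ℝ, E)) (mem_chart_source E x)).hasMFDerivAt).mfderiv
  have h4 := congr($(h1.mfderiv_eq.trans h3) v)
  refine h4.trans ((congrArg (mfderiv 𝓘(ℝ, E) 𝓘(ℝ, ℂ) (fun z ↦ η.inChart x z w)
    (extChartAt 𝓘(ℝ, E) x x)) (mfderiv_extChartAt_self_apply v)).trans ?_)
  rw [mfderiv_eq_fderiv]
  exact congr($(fderiv_continuousAlternatingMap_apply_const hd w) v)

lemma d_apply (η : ComplexForm E M k) (x : M) (v : Fin (k + 1) → TangentSpace 𝓘(ℝ, E) x) :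
    η.d x v = ∑ j : Fin (k + 1), (-1) ^ (j : ℕ) *
      fderiv ℝ (η.inChart x) (extChartAt 𝓘(ℝ, E) x x) (v j) (j.removeNth v) := by
  have h : η.d x v = extDeriv (η.inChart x) (extChartAt 𝓘(ℝ, E) x x) v :=
    congrArg (extDeriv (η.inChart x) (extChartAt 𝓘(ℝ, E) x x)) <|
      funext fun j ↦ mfderiv_extChartAt_self_apply (v j)
  exact h.trans ((ContinuousAlternatingMap.alternatizeUncurryFin_apply _ _).trans
    (Finset.sum_congr rfl fun j _ ↦ by rw [zsmul_eq_mul]; push_cast; rfl))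

end ComplexForm

end Coordinates

/-! ### Cancellation of symmetric connection terms under alternation -/

section AlternatingSum

/-- Terms are indexed by two slots of `v`: the one removed and the one whose vector is replaced.
Exchanging their roles preserves `Γ` by symmetry and reverses the sign. -/
lemma sum_neg_one_pow_mul_update_removeNth_eq_zero {V : Type*} [AddCommGroup V] [Module ℝ V]
    [TopologicalSpace V] {k : ℕ} (α : V [⋀^Fin k]→L[ℝ] ℂ) {Γ : V → V → V}
    (hΓ : ∀ v w, Γ v w = Γ w v) (v : Fin (k + 1) → V) :
    ∑ j : Fin (k + 1), (-1) ^ (j : ℕ) * ∑ i, α (Function.update (j.removeNth v) i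
      (Γ (v j) (j.removeNth v i))) = 0 := by
  cases k with
  | zero => simp
  | succ k =>
    have hins (u : Fin k → V) (i : Fin (k + 1)) (z : V) :
        α (i.insertNth z u) = (-1) ^ (i : ℕ) * α (Matrix.vecCons z u) := by
      have := α.toAlternatingMap.map_insertNth i z u
      simpa using this
    simp only [Finset.mul_sum]
    -- For `i ≤ j` this pairs the two terms in which slots `i.castSucc` and `j.succ` of `v` play
    -- both roles. With `Γ` moved to the front by `hins`, the signs are `(-1)^(i + j)` and `(-1)^(i
    -- + j + 1)`.
    rw [Fin.sum_sum_eq_sum_triangle_add]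
    refine Finset.sum_eq_zero fun i _ ↦ Finset.sum_eq_zero fun j hj ↦ ?_
    rw [Finset.mem_Ici] at hj
    simp only [← Fin.insertNth_removeNth, hins]
    rw [Fin.removeNth_removeNth_eq_swap v i j.succ]
    have H₁ : i.castSucc.succAbove j = j.succ := by simp [Fin.succAbove_of_le_castSucc, hj]
    have H₂ : j.predAbove i.castSucc = i := by simp [Fin.predAbove_of_le_castSucc, hj]
    have H₃ : j.succ.succAbove i = i.castSucc := by simp [Fin.succAbove_of_castSucc_lt, hj]
    have H₄ : i.predAbove j.succ = j := by simp [Fin.predAbove_of_castSucc_lt, hj]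
    simp only [Fin.removeNth_apply, H₁, H₃, H₄, hΓ (v j.succ), Fin.val_castSucc, Fin.val_succ]
    ring

end AlternatingSum

/-! ### The covariant derivative of a form -/

section CovariantDerivative

open scoped Topology

variable {E : Type*} [NormedAddCommGroup E] [NormedSpace ℝ E]
  {M : Type*} [TopologicalSpace M] [ChartedSpace E M] [IsManifold 𝓘(ℝ, E) ∞ M] {k : ℕ} {x : M}
  {D : CovariantDerivative 𝓘(ℝ, E) E (TangentSpace 𝓘(ℝ, E) : M → Type _)}

namespace ComplexForm

variable {η : ComplexForm E M k}

lemma covDeriv_neg (v : TangentSpace 𝓘(ℝ, E) x) (X : Fin k → TangentField E M) :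
    η.covDeriv D x (-v) X = -η.covDeriv D x v X := by
  have h (w : Fin k → TangentSpace 𝓘(ℝ, E) x) (i : Fin k) (z : TangentSpace 𝓘(ℝ, E) x) :
      η x (Function.update w i (-z)) = -η x (Function.update w i z) :=
    (η x).toMultilinearMap.map_update_neg w i z
  simp only [covDeriv, map_neg, h, Finset.sum_neg_distrib]
  ring

/-- The term with `df(v)` from differentiating `η(…, fY, …)` cancels the one from the Leibniz rule
for `D (fY)`. -/
lemma tensorialAt_covDeriv (hη : η.IsSmooth) (v : TangentSpace 𝓘(ℝ, E) x)
    {X : Fin k → TangentField E M} (hX : ∀ j, MDiffAt (T% (X j)) x) (i : Fin k) :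
    TensorialAt 𝓘(ℝ, E) E (fun Y : TangentField E M ↦ η.covDeriv D x v (Function.update X i Y)) x := by
  have hupd {Y : TangentField E M} (hY : MDiffAt (T% Y) x) (j : Fin k) :
      MDiffAt (T% (Function.update X i Y j)) x := by
    rcases eq_or_ne j i with rfl | hj
    · simpa using hY
    · simpa [hj] using hX j
  have hval (Y : TangentField E M) (y : M) : (fun j ↦ Function.update X i Y j y) =
      Function.update (fun j ↦ X j y) i (Y y) := by
    funext j
    rcases eq_or_ne j i with rfl | hj <;> simp [*]
  have hdiff {Y : TangentField E M} (hY : MDiffAt (T% Y) x) := hη.mdifferentiableAt_apply (hupd hY)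
  -- Separates the one term that differentiates `Y` from those where `Y` enters only through its
  -- value at `x`.
  have hsum (Y : TangentField E M) : ∑ j, η x (Function.update (fun j ↦ Function.update X i Y j x)
        j (D (Function.update X i Y j) x v)) =
      η x (Function.update (fun j ↦ X j x) i (D Y x v)) + ∑ j ∈ Finset.univ.erase i,
        η x (Function.update (Function.update (fun j ↦ X j x) j (D (X j) x v)) i (Y x)) := by
    rw [← Finset.add_sum_erase _ _ (Finset.mem_univ i), hval]
    congr 1
    · simp
    · refine Finset.sum_congr rfl fun j hj ↦ ?_
      have hj : j ≠ i := by simpa using hj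
      rw [Function.update_of_ne hj, Function.update_comm hj.symm]
  have hsmul (y : M) (w : Fin k → TangentSpace 𝓘(ℝ, E) y) (c : ℝ) (z : TangentSpace 𝓘(ℝ, E) y) :
      η y (Function.update w i (c • z)) = c • η y (Function.update w i z) :=
    (η y).toMultilinearMap.map_update_smul w i c z
  have hadd (y : M) (w : Fin k → TangentSpace 𝓘(ℝ, E) y) (z z' : TangentSpace 𝓘(ℝ, E) y) :
      η y (Function.update w i (z + z')) =
        η y (Function.update w i z) + η y (Function.update w i z') :=
    (η y).toMultilinearMap.map_update_add w i z z'
  simp only [hval] at hdiff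
  constructor
  · intro f Y hf hY
    have h1 := mvfderiv_smul hf (hdiff hY)
    have h2 := D.isCovariantDerivativeOnUniv.leibniz hY hf
    simp only [covDeriv, hsum]
    simp only [hval, Pi.smul_apply', hsmul, h2]
    have h1' := congr($h1 v)
    refine Eq.trans (congrArg₂ _ h1' rfl) ?_
    simp only [add_apply, smul_apply, ContinuousLinearMap.smulRight_apply, hadd, hsmul,
      smul_sub, smul_add, Finset.smul_sum]
    ring
  · intro Y Y' hY hY'
    have h1 := mvfderiv_add (hdiff hY) (hdiff hY')
    have h2 := D.isCovariantDerivativeOnUniv.add hY hY'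
    simp only [covDeriv, hsum]
    simp only [hval, Pi.add_apply, hadd, h2]
    have h1' := congr($h1 v)
    refine Eq.trans (congrArg₂ _ h1' rfl) ?_
    simp only [add_apply, hadd, Finset.sum_add_distrib]
    ring

variable [FiniteDimensional ℝ E]

/-- By tensoriality, the fields can be exchanged one slot at a time. -/
lemma covDeriv_congr (hη : η.IsSmooth) (v : TangentSpace 𝓘(ℝ, E) x)
    {X X' : Fin k → TangentField E M} (hX : ∀ j, MDiffAt (T% (X j)) x)
    (hX' : ∀ j, MDiffAt (T% (X' j)) x) (h : ∀ j, X j x = X' j x) :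
    η.covDeriv D x v X = η.covDeriv D x v X' := by
  have key (S : Finset (Fin k)) : η.covDeriv D x v (S.piecewise X X') = η.covDeriv D x v X' := by
    induction S using Finset.induction_on with
    | empty => simp
    | insert i S hi ih =>
      have hp (j : Fin k) : MDiffAt (T% (S.piecewise X X' j)) x := by
        by_cases hj : j ∈ S
        · simpa [hj] using hX j
        · simpa [hj] using hX' j
      rw [← ih, Finset.piecewise_insert,
        (tensorialAt_covDeriv (D := D) hη v hp i).pointwise (hX i) (hX' i) (h i)]
      congr 1
      rw [Function.update_eq_self_iff]
      simp [hi]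
  simpa using key Finset.univ

variable (D η) in
/-- The value `(∇_v η)(w₁, …, w_k)` of the covariant derivative on tangent vectors. -/
def covDerivAt (x : M) (v : TangentSpace 𝓘(ℝ, E) x) (w : Fin k → TangentSpace 𝓘(ℝ, E) x) : ℂ :=
  η.covDeriv D x v fun j ↦ FiberBundle.extend E (w j)

lemma covDerivAt_apply (hη : η.IsSmooth) (v : TangentSpace 𝓘(ℝ, E) x)
    {X : Fin k → TangentField E M} (hX : ∀ j, MDiffAt (T% (X j)) x)
    {w : Fin k → TangentSpace 𝓘(ℝ, E) x} (hw : ∀ j, X j x = w j) :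
    η.covDerivAt D x v w = η.covDeriv D x v X :=
  covDeriv_congr hη v (fun j ↦ FiberBundle.mdifferentiableAt_extend ..) hX fun j ↦ by simp [hw]

/-- The exterior derivative is the alternation of the covariant derivative of a torsion-free
connection. -/
lemma d_apply_eq_sum_covDerivAt (hη : η.IsSmooth) (hD : D.torsion = 0)
    (v : Fin (k + 1) → TangentSpace 𝓘(ℝ, E) x) :
    η.d x v = ∑ j : Fin (k + 1), (-1) ^ (j : ℕ) * η.covDerivAt D x (v j) (j.removeNth v) := by
  -- For commuting coordinate fields, vanishing torsion is the symmetry of the Christoffel symbols.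
  have hsymm (u w : TangentSpace 𝓘(ℝ, E) x) :
      D (FiberBundle.extend E w) x u = D (FiberBundle.extend E u) x w := by
    have := (D.torsion_eq_zero_iff.1 hD) (FiberBundle.mdifferentiableAt_extend 𝓘(ℝ, E) E u)
      (FiberBundle.mdifferentiableAt_extend 𝓘(ℝ, E) E w)
    rw [mlieBracket_extend_extend, sub_eq_zero] at this
    simpa using this
  have h := sum_neg_one_pow_mul_update_removeNth_eq_zero (η x)
    (Γ := fun u w ↦ D (FiberBundle.extend E w) x u) hsymm v
  simp only [covDerivAt, covDeriv, hη.mvfderiv_apply_extend, mul_sub, Finset.sum_sub_distrib,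
    FiberBundle.extend_apply_self]
  rw [d_apply]
  exact (sub_eq_self.2 h).symm

/-- Differentiating `η(…, A Xₗ, …) = √-1 η(…, Xₗ, …)` and using `∇A = 0` shows that `∇_v η` keeps
the type `(k, 0)`. -/
lemma covDerivAt_update (hη : η.IsSmooth) {A : TangentEndo E M} (hA : A.IsSmooth)
    (hA2 : ∀ x v, A x (A x v) = -v) (hDA : A.IsPreservedBy D) (htype : η.HasType A k)
    (v : TangentSpace 𝓘(ℝ, E) x) (w : Fin k → TangentSpace 𝓘(ℝ, E) x) (l : Fin k) :
    η.covDerivAt D x v (Function.update w l (A x (w l))) =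
      Complex.I * η.covDerivAt D x v w := by
  set X : Fin k → TangentField E M := fun j ↦ FiberBundle.extend E (w j) with hXdef
  have hX (j : Fin k) : MDiffAt (T% (X j)) x := FiberBundle.mdifferentiableAt_extend ..
  have hXw (j : Fin k) : X j x = w j := FiberBundle.extend_apply_self _ _
  set Y : Fin k → TangentField E M := Function.update X l (A.act (X l)) with hYdef
  have hY (j : Fin k) : MDiffAt (T% (Y j)) x := by
    rcases eq_or_ne j l with rfl | hj
    · simpa [hYdef] using HypercomplexStructure.mdiffAt_act hA (hX j)
    · simpa [hYdef, hj] using hX j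
  have hval (y : M) : (fun j ↦ Y j y) =
      Function.update (fun j ↦ X j y) l (A y (X l y)) := by
    funext j
    rcases eq_or_ne j l with rfl | hj
    · simp [hYdef, TangentEndo.act]
    · simp [hYdef, hj]
  have hη2 (y : M) (u : Fin k → TangentSpace 𝓘(ℝ, E) y) :
      η y (Function.update u l (A y (u l))) = Complex.I * η y u :=
    apply_update_of_typeComponent_eq (hA2 y) (htype y) u l
  -- The vector `A (w l)` is extended by the field `A Xₗ`, to which `∇A = 0` applies, instead of by
  -- its coordinate extension.
  rw [covDerivAt_apply hη v hY fun j ↦ (congrFun (hval x) j).trans (by simp only [hXw])]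
  rw [covDerivAt, covDeriv, covDeriv, mul_sub, Finset.mul_sum]
  congr 1
  · simp only [hval, hη2 _ fun j ↦ X j _]
    exact mvfderiv_clm_comp (Complex.I • ContinuousLinearMap.id ℝ ℂ)
      (hη.mdifferentiableAt_apply hX) v
  · refine Finset.sum_congr rfl fun j _ ↦ ?_
    rw [hval]
    rcases eq_or_ne j l with rfl | hj
    · have := hη2 x (Function.update (fun i ↦ X i x) j (D (X j) x v))
      simp only [Function.update_self, Function.update_idem] at this ⊢
      rw [← this, hYdef, Function.update_self, hDA _ _ (hX j)]
    · have := hη2 x (Function.update (fun i ↦ X i x) j (D (X j) x v))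
      rw [Function.update_of_ne hj.symm] at this
      rw [← this, hYdef, Function.update_of_ne hj, Function.update_comm hj]

/-- Differentiate the reality condition on the fields `J Xⱼ`: conjugation is real-linear and `∇J =
0`, so both pass through `∇_v`. -/
lemma conj_covDerivAt (h : HypercomplexStructure E M) (hη : η.IsSmooth)
    (hDJ : h.J.IsPreservedBy D) (hreal : η.IsHReal h)
    (v : TangentSpace 𝓘(ℝ, E) x) (w : Fin k → TangentSpace 𝓘(ℝ, E) x) :
    (starRingEnd ℂ) (η.covDerivAt D x v fun j ↦ h.J x (w j)) = η.covDerivAt D x v w := by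
  set X : Fin k → TangentField E M := fun j ↦ FiberBundle.extend E (w j) with hXdef
  have hX (j : Fin k) : MDiffAt (T% (X j)) x := FiberBundle.mdifferentiableAt_extend ..
  have hXw (j : Fin k) : X j x = w j := FiberBundle.extend_apply_self _ _
  have hJX (j : Fin k) : MDiffAt (T% (h.J.act (X j))) x :=
    HypercomplexStructure.mdiffAt_act h.smooth_J (hX j)
  rw [covDerivAt_apply hη v hJX fun j ↦ congrArg (h.J x) (hXw j)]
  rw [covDerivAt, covDeriv, covDeriv, map_sub, map_sum]
  congr 1
  · refine (mvfderiv_clm_comp Complex.conjCLE.toContinuousLinearMap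
      (hη.mdifferentiableAt_apply hJX) v).symm.trans ?_
    congr 2
    funext y
    exact hreal y fun j ↦ X j y
  · refine Finset.sum_congr rfl fun i _ ↦ ?_
    rw [hDJ _ _ (hX i)]
    refine Eq.trans ?_ (hreal x (Function.update (fun j ↦ X j x) i (D (X i) x v)))
    refine congrArg (starRingEnd ℂ) (congrArg (η x) (funext fun j ↦ ?_))
    rcases eq_or_ne j i with rfl | hj
    · simp
    · simp [hj, TangentEndo.act]

theorem IsHolomorphic.isParallel_of_isHReal {h : HypercomplexStructure E M}
    (hD : h.IsObataConnection D) (hhol : η.IsHolomorphic h.I) (hreal : η.IsHReal h) :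
    η.IsParallel D := by
  have hzero (x : M) (v : TangentSpace 𝓘(ℝ, E) x) (w : Fin k → TangentSpace 𝓘(ℝ, E) x) :
      η.covDerivAt D x v w + Complex.I * η.covDerivAt D x (h.I x v) w = 0 :=
    add_I_mul_eq_zero_of_typeComponent_eq_zero (h.I_sq x) (fun v w ↦ covDeriv_neg v _)
      (covDerivAt_update hhol.smooth h.smooth_I h.I_sq hD.preserves_I hhol.hasType)
      (d_apply_eq_sum_covDerivAt hhol.smooth hD.torsion_eq_zero) (hhol.dbar_eq_zero x) v w
  intro x v X hX
  rw [← covDerivAt_apply hhol.smooth v hX fun _ ↦ rfl]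
  set w : Fin k → TangentSpace 𝓘(ℝ, E) x := fun j ↦ X j x
  have h1 := hzero x v w
  -- Conjugating the equation at the vectors `J wⱼ` fixes both covariant derivatives and turns `√-1`
  -- into `-√-1`.
  have h2 := congrArg (starRingEnd ℂ) (hzero x v fun j ↦ h.J x (w j))
  rw [map_add, map_mul, conj_covDerivAt h hhol.smooth hD.preserves_J hreal,
    conj_covDerivAt h hhol.smooth hD.preserves_J hreal, Complex.conj_I, map_zero] at h2
  linear_combination (1 / 2 : ℂ) * h1 + (1 / 2 : ℂ) * h2

end ComplexForm

end CovariantDerivative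

end

theorem mainTheorem9 (E : Type*) [NormedAddCommGroup E] [NormedSpace ℝ E] [FiniteDimensional ℝ E]
    (n : ℕ) (hdim : Module.finrank ℝ E = 4 * n)
    (M : Type*) [TopologicalSpace M] [ChartedSpace E M] [IsManifold 𝓘(ℝ, E) ∞ M]
    (h : HypercomplexStructure E M)
    (D : CovariantDerivative 𝓘(ℝ, E) E (TangentSpace 𝓘(ℝ, E) : M → Type _))
    (hD : h.IsObataConnection D)
    (η : ComplexForm E M (2 * n)) (hhol : η.IsHolomorphic h.I) (hreal : η.IsHReal h) :
    η.IsParallel D :=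
  hhol.isParallel_of_isHReal hD hreal
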